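/- Let $X$ be a nonempty set. A function $d:X\times X\to[0,\infty)$ is a quasi-metric if there are $C_0,C_1\in(0,\infty)$ such that $d(x,y)=0\iff x=y$, $d(y,x)\le C_0\,d(x,y)$ and $d(x,y)\le C_1\max\{d(x,z),d(z,y)\}$ for all $x,y,z\in X$. Put $B_d(x,r)=\{y\in X:d(x,y)<r\}$; a set is open in the topology $\tau_d$ if it contains, with each of its points $x$, a ball $B_d(x,r)$, $r>0$. Quasi-metrics $d,\varrho$ are equivalent, $d\approx\varrho$, if $\kappa^{-1}\varrho\le d\le\kappa\varrho$ for some $\kappa\in(0,\infty)$. $(X,d)$ is totally bounded if for every $\varepsilon>0$ finitely many balls $B_d(x_i,\varepsilon)$ cover $X$. $(X,d,\mu)$ is a quasi-metric-measure space if $d$ is a quasi-metric and $\mu$ is a nonnegative measure, on a $\sigma$-algebra containing the Borel sets of $\tau_d$, such that all balls $B_d(x,r)$ are measurable and $0<\mu(B_d(x,r))<\infty$ for all $x\in X$, $r\in(0,\infty)$. For $\alpha\in(0,\infty)$ and a measurable $u:X\to\mathbb R$, an $\alpha$-fractional gradient of $u$ is a sequence $\vec g=(g_k)_{k\in\mathbb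 Z}$ of measurable functions $g_k:X\to[0,\infty]$ for which there is a measurable set $E$ with $\mu(E)=0$ and $$|u(x)-u(y)|\le d(x,y)^\alpha\,(g_k(x)+g_k(y))$$ for all $k\in\mathbb Z$ and $x,y\in X\setminus E$ with $2^{-k-1}\le d(x,y)<2^{-k}$. A measurable $g:X\to[0,\infty]$ is an $\alpha$-gradient of $u$ if, for some measurable $E$ with $\mu(E)=0$, $|u(x)-u(y)|\le d(x,y)^\alpha(g(x)+g(y))$ for all $x,y\in X\setminus E$. For $p\in(0,\infty)$ and $q\in(0,\infty]$ let $M^\alpha_{p,q}(X,d,\mu)$, $N^\alpha_{p,q}(X,d,\mu)$ and $M^{\alpha,p}(X,d,\mu)$ be the spaces of all measurable $u\in L^p(X,\mu)$ for which, respectively, $$\inf_{\vec g}\big\|\,\|(g_k)_k\|_{\ell^q(\mathbb Z)}\big\|_{L^p(X,\mu)},\qquad \inf_{\vec g}\big\|(\|g_k\|_{L^p(X,\mu)})_k\big\|_{\ell^q(\mathbb Z)},\qquad \inf_{g}\|g\|_{L^p(X,\mu)}$$ is finite (infima over all $\alpha$-fractional gradients $\vec g$, respectively all $\alpha$-gradients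 $g$, of $u$), with the quasi-norm given by the sum of $\|u\|_{L^p(X,\mu)}$ and this infimum. A continuous embedding of such a space into $L^p(X,\nu)$ is compact if every bounded sequence has a subsequence that converges in $L^p(X,\nu)$. **Theorem.** Let $(X,d,\mu)$ be a quasi-metric-measure space and let $\nu$ be a measure (on the same $\sigma$-algebra) with $\nu\le C\mu$ for some constant $C\in(0,\infty)$. Suppose that $\mu$ is $\nu$-integrable, i.e. there is a quasi-metric $\varrho\approx d$ on $X$ such that, for each $r\in(0,\infty)$, all balls $B_\varrho(x,r)$ are measurable, the map $x\mapsto\mu(B_\varrho(x,r))$ is measurable, and $$\int_X\frac{1}{\mu(B_\varrho(x,r))}\,d\nu(x)<\infty .$$ Then, for all $\alpha,p\in(0,\infty)$ and $q\in(0,\infty]$, the embeddings $$M^\alpha_{p,q}(X,d,\mu)\hookrightarrow L^p(X,\nu),\qquad N^\alpha_{p,q}(X,d,\mu)\hookrightarrow L^p(X,\nu),\qquad M^{\alpha,p}(X,d,\mu)\hookrightarrow L^p(X,\nu)$$ are well defined, continuous and compact. In particular, these embeddings are compact whenever $(X,d)$ is totally bounded. -/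

import Mathlib

open MeasureTheory Filter Topology
open scoped ENNReal NNReal

/-- `d` is a quasi-metric on `X`. -/
structure IsQuasiMetric {X : Type*} (d : X → X → ℝ) : Prop where
  nonneg : ∀ x y, 0 ≤ d x y
  eq_zero_iff : ∀ x y, d x y = 0 ↔ x = y
  quasi_symm : ∃ C₀ : ℝ, 0 < C₀ ∧ ∀ x y, d y x ≤ C₀ * d x y
  quasi_triangle : ∃ C₁ : ℝ, 0 < C₁ ∧ ∀ x y z, d x y ≤ C₁ * max (d x z) (d z y)

/-- Equivalence `d ≈ ρ` of two quasi-metrics. -/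
def QuasiMetricEquiv {X : Type*} (d ρ : X → X → ℝ) : Prop :=
  ∃ κ : ℝ, 0 < κ ∧ ∀ x y, κ⁻¹ * ρ x y ≤ d x y ∧ d x y ≤ κ * ρ x y

/-- The ball `B_d(x, r) = {y : d(x, y) < r}`; the centre is the first argument of `d`. -/
def quasiBall {X : Type*} (d : X → X → ℝ) (x : X) (r : ℝ) : Set X := {y | d x y < r}

/-- The topology `τ_d`: a set is open if it contains a ball around each of its points. -/
@[reducible] def quasiTopology {X : Type*} (d : X → X → ℝ) : TopologicalSpace X where
  IsOpen O := ∀ x ∈ O, ∃ r : ℝ, 0 < r ∧ quasiBall d x r ⊆ O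
  isOpen_univ := fun _ _ => ⟨1, one_pos, Set.subset_univ _⟩
  isOpen_inter := by
    intro s t hs ht x hx
    obtain ⟨r₁, h₁, hs'⟩ := hs x hx.1
    obtain ⟨r₂, h₂, ht'⟩ := ht x hx.2
    refine ⟨min r₁ r₂, lt_min h₁ h₂, fun y hy => ⟨hs' ?_, ht' ?_⟩⟩
    · exact lt_of_lt_of_le (show d x y < min r₁ r₂ from hy) (min_le_left _ _)
    · exact lt_of_lt_of_le (show d x y < min r₁ r₂ from hy) (min_le_right _ _)
  isOpen_sUnion := by
    intro S hS x hx
    obtain ⟨s, hs, hxs⟩ := hx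
    obtain ⟨r, hr, hsub⟩ := hS s hs x hxs
    exact ⟨r, hr, hsub.trans (Set.subset_sUnion_of_mem hs)⟩

/-- Total boundedness of `(X, d)`: finite `ε`-nets for all `ε > 0`. -/
def QuasiTotallyBounded {X : Type*} (d : X → X → ℝ) : Prop :=
  ∀ ε : ℝ, 0 < ε → ∃ t : Set X, t.Finite ∧ ∀ x, ∃ y ∈ t, x ∈ quasiBall d y ε

/-- `(X, d, μ)` is a quasi-metric-measure space. The sigma-algebra on which `μ` is defined
contains the Borel sets of `τ_d` and all balls, but may be larger. -/
structure IsQuasiMetricMeasureSpace {X : Type*} [mX : MeasurableSpace X]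
    (d : X → X → ℝ) (μ : Measure X) : Prop where
  isQuasiMetric : IsQuasiMetric d
  borel_le : @borel X (quasiTopology d) ≤ mX
  measurableSet_ball : ∀ x r, 0 < r → MeasurableSet (quasiBall d x r)
  ball_pos : ∀ x r, 0 < r → 0 < μ (quasiBall d x r)
  ball_lt_top : ∀ x r, 0 < r → μ (quasiBall d x r) < ∞

/-- `μ` is `ν`-integrable on `(X, d)`. -/
def IsIntegrableMeasure {X : Type*} [MeasurableSpace X]
    (d : X → X → ℝ) (μ ν : Measure X) : Prop :=
  ∃ ρ : X → X → ℝ, IsQuasiMetric ρ ∧ QuasiMetricEquiv d ρ ∧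
    (∀ x r, 0 < r → MeasurableSet (quasiBall ρ x r)) ∧
    ∀ r, 0 < r → Measurable (fun x => μ (quasiBall ρ x r)) ∧
      ∫⁻ x, (μ (quasiBall ρ x r))⁻¹ ∂ν < ∞

/-- The `ℓ^q(ℤ)` quasi-norm of a nonnegative sequence, `0 < q ≤ ∞`. -/
noncomputable def lqNorm (q : ℝ≥0∞) (a : ℤ → ℝ≥0∞) : ℝ≥0∞ :=
  if q = ∞ then ⨆ k, a k else (∑' k, a k ^ q.toReal) ^ (1 / q.toReal)

/-- `g = (g_k)` is an `α`-fractional gradient of `u`. -/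
def IsFractionalGradient {X : Type*} [MeasurableSpace X] (d : X → X → ℝ) (μ : Measure X)
    (α : ℝ) (u : X → ℝ) (g : ℤ → X → ℝ≥0∞) : Prop :=
  (∀ k, Measurable (g k)) ∧
  ∃ E : Set X, MeasurableSet E ∧ μ E = 0 ∧
    ∀ k : ℤ, ∀ x ∉ E, ∀ y ∉ E, (2 : ℝ) ^ (-k - 1) ≤ d x y → d x y < (2 : ℝ) ^ (-k) →
      ENNReal.ofReal |u x - u y| ≤ ENNReal.ofReal (d x y ^ α) * (g k x + g k y)

/-- `g` is an `α`-gradient of `u`. -/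
def IsHajlaszGradient {X : Type*} [MeasurableSpace X] (d : X → X → ℝ) (μ : Measure X)
    (α : ℝ) (u : X → ℝ) (g : X → ℝ≥0∞) : Prop :=
  Measurable g ∧
  ∃ E : Set X, MeasurableSet E ∧ μ E = 0 ∧
    ∀ x ∉ E, ∀ y ∉ E,
      ENNReal.ofReal |u x - u y| ≤ ENNReal.ofReal (d x y ^ α) * (g x + g y)

/-- The homogeneous Hajlasz–Triebel–Lizorkin semi-norm, with value `∞` off the space. -/
noncomputable def homTriebelLizorkinNorm {X : Type*} [MeasurableSpace X] (d : X → X → ℝ)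
    (μ : Measure X) (α : ℝ) (p q : ℝ≥0∞) (u : X → ℝ) : ℝ≥0∞ :=
  ⨅ (g : ℤ → X → ℝ≥0∞) (_ : IsFractionalGradient d μ α u g),
    eLpNorm (fun x => lqNorm q (fun k => g k x)) p μ

/-- The homogeneous Hajlasz–Besov semi-norm, with value `∞` off the space. -/
noncomputable def homBesovNorm {X : Type*} [MeasurableSpace X] (d : X → X → ℝ)
    (μ : Measure X) (α : ℝ) (p q : ℝ≥0∞) (u : X → ℝ) : ℝ≥0∞ :=
  ⨅ (g : ℤ → X → ℝ≥0∞) (_ : IsFractionalGradient d μ α u g),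
    lqNorm q (fun k => eLpNorm (g k) p μ)

/-- The homogeneous Hajlasz–Sobolev semi-norm, with value `∞` off the space. -/
noncomputable def homHajlaszSobolevNorm {X : Type*} [MeasurableSpace X] (d : X → X → ℝ)
    (μ : Measure X) (α : ℝ) (p : ℝ≥0∞) (u : X → ℝ) : ℝ≥0∞ :=
  ⨅ (g : X → ℝ≥0∞) (_ : IsHajlaszGradient d μ α u g), eLpNorm g p μ

/-- Given a homogeneous semi-norm `H`, the functions of the corresponding inhomogeneous space:
the measurable `u` in `L^p(X, μ)` with `H u < ∞`. -/
def inhomSpace {X : Type*} [MeasurableSpace X] (μ : Measure X) (p : ℝ≥0∞)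
    (H : (X → ℝ) → ℝ≥0∞) : Set (X → ℝ) :=
  {u | Measurable u ∧ MemLp u p μ ∧ H u < ∞}

/-- The inhomogeneous quasi-norm `‖u‖_{L^p(X, μ)} + H u`. -/
noncomputable def inhomNorm {X : Type*} [MeasurableSpace X] (μ : Measure X) (p : ℝ≥0∞)
    (H : (X → ℝ) → ℝ≥0∞) (u : X → ℝ) : ℝ≥0∞ :=
  eLpNorm u p μ + H u

/-- The space `S` of functions with quasi-norm `N` embeds compactly into `L^p(X, ν)`: the identity
is well defined and bounded, and every `N`-bounded sequence in `S` has a subsequence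
that converges in `L^p(X, ν)`. (For `p < 1` there is no topology on Mathlib's `Lp`, so convergence
is expressed through `eLpNorm`.) -/
def IsCompactlyEmbeddedInLp {X : Type*} [MeasurableSpace X] (S : Set (X → ℝ))
    (N : (X → ℝ) → ℝ≥0∞) (p : ℝ≥0∞) (ν : Measure X) : Prop :=
  (∀ u ∈ S, MemLp u p ν) ∧
  (∃ K : ℝ≥0, ∀ u ∈ S, eLpNorm u p ν ≤ K * N u) ∧
  ∀ u : ℕ → X → ℝ, (∀ n, u n ∈ S) → (∃ M : ℝ≥0, ∀ n, N (u n) ≤ M) →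
    ∃ f : X → ℝ, MemLp f p ν ∧ ∃ φ : ℕ → ℕ, StrictMono φ ∧
      Tendsto (fun n => eLpNorm (u (φ n) - f) p ν) atTop (𝓝 0)

/-- `M^α_{p,q}(X, d, μ)` embeds compactly into `L^p(X, ν)`. -/
def TriebelLizorkinCompactlyEmbeds {X : Type*} [MeasurableSpace X] (d : X → X → ℝ)
    (μ ν : Measure X) (α : ℝ) (p q : ℝ≥0∞) : Prop :=
  IsCompactlyEmbeddedInLp (inhomSpace μ p (homTriebelLizorkinNorm d μ α p q))
    (inhomNorm μ p (homTriebelLizorkinNorm d μ α p q)) p ν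

/-- `N^α_{p,q}(X, d, μ)` embeds compactly into `L^p(X, ν)`. -/
def BesovCompactlyEmbeds {X : Type*} [MeasurableSpace X] (d : X → X → ℝ)
    (μ ν : Measure X) (α : ℝ) (p q : ℝ≥0∞) : Prop :=
  IsCompactlyEmbeddedInLp (inhomSpace μ p (homBesovNorm d μ α p q))
    (inhomNorm μ p (homBesovNorm d μ α p q)) p ν

/-- `M^{α,p}(X, d, μ)` embeds compactly into `L^p(X, ν)`. -/
def HajlaszSobolevCompactlyEmbeds {X : Type*} [MeasurableSpace X] (d : X → X → ℝ)
    (μ ν : Measure X) (α : ℝ) (p : ℝ≥0∞) : Prop :=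
  IsCompactlyEmbeddedInLp (inhomSpace μ p (homHajlaszSobolevNorm d μ α p))
    (inhomNorm μ p (homHajlaszSobolevNorm d μ α p)) p ν

/-! The argument is of Kolmogorov–Riesz type. Write `t` for the exponent `p`. A bound on the
gradient gives, off a null set, `|u x - u y| ≤ h x + h y` at distances below `r`, and `∫ h ^ t ∂μ`
is small as `r → 0`, uniformly over a bounded family (`hajlaszSobolev_oscillationBound`,
`besov_oscillationBound`).

Split `X` into finitely many disjoint pieces of diameter below `r` and a remainder `R`. On each
piece, `u` is close in `L^t(ν)` to its value at a point where `h ^ t` is at most about its mean. On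
`R`, comparing `u x` with `u` at a good point of a small neighbourhood `B x` bounds `|u x| ^ t` by a
multiple of `h x ^ t + ∫ (h ^ t + |u| ^ t) ∂μ / μ (B x)`. Hence the tail is small as soon as `∫ 1 /
μ (B x) ∂ν` over `R` is small. Integrability of `μ` provides this, since `R` shrinks to the empty
set; under total boundedness `R` can be taken empty.

Up to small errors the sequence therefore consists of step functions on fixed pieces with bounded
values. A subsequence is Cauchy in `L^t(ν)`, and completeness finishes. Values at points replace
averages of `u`, so `t < 1` needs no separate treatment. -/

theorem ENNReal.add_rpow_le_two_rpow_mul (a b : ℝ≥0∞) {t : ℝ} (ht : 0 < t) :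
    (a + b) ^ t ≤ 2 ^ t * (a ^ t + b ^ t) := by
  have key : ∀ a b : ℝ≥0∞, a ≤ b → (a + b) ^ t ≤ 2 ^ t * (a ^ t + b ^ t) := fun a b hab => by
    calc (a + b) ^ t ≤ (2 * b) ^ t := by
          gcongr
          rw [two_mul]
          gcongr
      _ = 2 ^ t * b ^ t := ENNReal.mul_rpow_of_nonneg _ _ ht.le
      _ ≤ _ := by gcongr; exact le_add_self
  rcases le_total a b with h | h
  · exact key a b h
  · rw [add_comm a, add_comm (a ^ t)]
    exact key b a h

/-! ### Averaging estimates and completeness of `L^t` -/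

section Measure
variable {X : Type*} [MeasurableSpace X] {μ ν : Measure X}

/-- First moment method: off a null set, some point of `s` has value at most the mean over `s`. -/
theorem exists_mem_notMem_null_mul_measure_le {s E : Set X} (hs : MeasurableSet s)
    (hs0 : μ s ≠ 0) (hs1 : μ s ≠ ∞) (hE : μ E = 0) {F : X → ℝ≥0∞} (hFm : Measurable F)
    (hF : ∫⁻ x in s, F x ∂μ ≠ ∞) :
    ∃ y ∈ s, y ∉ E ∧ F y * μ s ≤ ∫⁻ x in s, F x ∂μ := by
  by_contra! H
  have hlt : ∀ᵐ x ∂μ.restrict s, (∫⁻ x in s, F x ∂μ) / μ s < F x := by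
    filter_upwards [ae_restrict_mem hs, ae_restrict_of_ae (measure_eq_zero_iff_ae_notMem.1 hE)]
      with x hx hxE
    exact ENNReal.div_lt_of_lt_mul (H x hx hxE)
  have h0 : μ.restrict s ≠ 0 := by rwa [Ne, Measure.restrict_eq_zero]
  have := lintegral_strict_mono h0 hFm.aemeasurable ?_ hlt
  · rw [lintegral_const, Measure.restrict_apply_univ, ENNReal.div_mul_cancel hs0 hs1] at this
    exact this.false
  · rw [lintegral_const, Measure.restrict_apply_univ, ENNReal.div_mul_cancel hs0 hs1]
    exact hF

theorem setLIntegral_le_mul_of_le_smul {C : ℝ≥0} (hν : ν ≤ C • μ) (s : Set X) (F : X → ℝ≥0∞) :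
    ∫⁻ x in s, F x ∂ν ≤ C * ∫⁻ x in s, F x ∂μ := by
  calc ∫⁻ x in s, F x ∂ν ≤ ∫⁻ x in s, F x ∂(C • μ) :=
        lintegral_mono' (Measure.restrict_mono le_rfl hν) le_rfl
    _ = _ := by rw [Measure.restrict_smul, lintegral_smul_measure]; rfl

/-- Completeness of `L^t` for all `t > 0`. -/
theorem exists_tendsto_lintegral_rpow_of_cauchy {t : ℝ} (ht : 0 < t) {u : ℕ → X → ℝ}
    (hu : ∀ n, Measurable (u n))
    (hc : ∀ ε : ℝ≥0∞, ε ≠ 0 → ∃ N, ∀ m ≥ N, ∀ n ≥ N, ∫⁻ x, ‖u m x - u n x‖ₑ ^ t ∂ν ≤ ε) :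
    ∃ f : X → ℝ, Measurable f ∧ Tendsto (fun n => ∫⁻ x, ‖u n x - f x‖ₑ ^ t ∂ν) atTop (𝓝 0) := by
  let b : ℕ → ℝ≥0∞ := fun n => 2⁻¹ ^ n
  have hb0 : ∀ n, b n ≠ 0 := fun n => pow_ne_zero _ (by simp)
  have hbt : ∀ n, b n ≠ ∞ := fun n => ENNReal.pow_ne_top (by simp)
  -- The threshold `b k ^ t * b k` is chosen so that Markov's inequality leaves measure at most `b k
  -- = 2⁻ᵏ` for the set where consecutive terms differ by `b k` or more; Borel–Cantelli then gives
  -- convergence almost everywhere.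
  obtain ⟨φ, hφ, hφc⟩ : ∃ φ : ℕ → ℕ, StrictMono φ ∧ ∀ k, ∀ m ≥ φ k, ∀ n ≥ φ k,
      ∫⁻ x, ‖u m x - u n x‖ₑ ^ t ∂ν ≤ b k ^ t * b k := by
    have := extraction_forall_of_eventually' (P := fun k N => ∀ m ≥ N, ∀ n ≥ N,
      ∫⁻ x, ‖u m x - u n x‖ₑ ^ t ∂ν ≤ b k ^ t * b k) ?_
    · obtain ⟨φ, h1, h2⟩ := this
      exact ⟨φ, h1, h2⟩
    · intro k
      obtain ⟨N, hN⟩ := hc (b k ^ t * b k)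
        (mul_ne_zero (by simp [ENNReal.rpow_eq_zero_iff, hb0, hbt]) (hb0 k))
      exact ⟨N, fun N' hN' m hm n hn => hN m (hN'.trans hm) n (hN'.trans hn)⟩
  have hae : ∀ᵐ x ∂ν, ∃ l, Tendsto (fun k => u (φ k) x) atTop (𝓝 l) := by
    have hmeas : ∀ k, ν {x | b k ^ t ≤ ‖u (φ k) x - u (φ (k + 1)) x‖ₑ ^ t} ≤ b k := by
      intro k
      have hpos : b k ^ t ≠ 0 := by simp [ENNReal.rpow_eq_zero_iff, hb0, hbt]
      have htop : b k ^ t ≠ ∞ := ENNReal.rpow_ne_top_of_nonneg ht.le (hbt k)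
      refine (meas_ge_le_lintegral_div (((hu _).sub (hu _)).enorm.pow_const t).aemeasurable
        hpos htop).trans ?_
      rw [ENNReal.div_le_iff hpos htop, mul_comm]
      exact hφc k _ le_rfl _ (hφ (Nat.lt_succ_self k)).le
    have hsum : ∑' k, ν {x | b k ^ t ≤ ‖u (φ k) x - u (φ (k + 1)) x‖ₑ ^ t} ≠ ∞ := by
      refine ne_top_of_le_ne_top ?_ (ENNReal.tsum_le_tsum hmeas)
      simp only [b]
      rw [ENNReal.tsum_geometric]
      simp
    filter_upwards [ae_eventually_notMem hsum] with x hx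
    obtain ⟨K, hK⟩ := eventually_atTop.1 hx
    have hcs : CauchySeq fun k => u (φ (k + K)) x := by
      refine cauchySeq_of_edist_le_geometric_two 2 (by simp) fun n => ?_
      have h1 := hK (n + K) le_add_self
      simp only [not_le] at h1
      have h2 := (ENNReal.rpow_lt_rpow_iff ht).1 h1
      rw [edist_eq_enorm_sub, show n + 1 + K = n + K + 1 by ring]
      refine h2.le.trans ?_
      simp only [b]
      rw [pow_add, div_eq_mul_inv, ← ENNReal.inv_pow, mul_comm]
      gcongr
      exact (pow_le_one₀ (by simp) (by simp)).trans (by norm_num)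
    obtain ⟨l, hl⟩ := cauchySeq_tendsto_of_complete hcs
    exact ⟨l, (tendsto_add_atTop_iff_nat K).1 hl⟩
  obtain ⟨f, hf, hlim⟩ := measurable_limit_of_tendsto_metrizable_ae
    (fun k => (hu (φ k)).aemeasurable) hae
  refine ⟨f, hf, ENNReal.tendsto_nhds_zero.2 fun ε hε => ?_⟩
  obtain ⟨N, hN⟩ := hc ε hε.ne'
  filter_upwards [eventually_ge_atTop N] with n hn
  calc ∫⁻ x, ‖u n x - f x‖ₑ ^ t ∂ν
      -- Fatou's lemma transfers the Cauchy bound to the limit of the subsequence, and does so for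
      -- the whole sequence.
      ≤ ∫⁻ x, liminf (fun k => ‖u n x - u (φ k) x‖ₑ ^ t) atTop ∂ν := by
        refine lintegral_mono_ae ?_
        filter_upwards [hlim] with x hx
        refine le_of_eq (Tendsto.liminf_eq ?_).symm
        exact ((ENNReal.continuous_rpow_const.tendsto _).comp
          ((continuous_enorm.tendsto _).comp (hx.const_sub (u n x))))
    _ ≤ liminf (fun k => ∫⁻ x, ‖u n x - u (φ k) x‖ₑ ^ t ∂ν) atTop :=
        lintegral_liminf_le fun k => ((hu _).sub (hu _)).enorm.pow_const t
    _ ≤ ε := by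
        refine liminf_le_of_frequently_le' (Eventually.frequently ?_)
        filter_upwards [eventually_ge_atTop N] with k hk
        exact hN n hn _ (hk.trans (hφ.id_le k))

theorem enorm_sub_rpow_le {t : ℝ} (ht : 0 < t) {a b : ℝ} {g k : ℝ≥0∞}
    (h : ENNReal.ofReal |a - b| ≤ g + k) : ‖a - b‖ₑ ^ t ≤ 2 ^ t * (g ^ t + k ^ t) := by
  rw [Real.enorm_eq_ofReal_abs]
  exact (ENNReal.rpow_le_rpow h ht.le).trans (ENNReal.add_rpow_le_two_rpow_mul _ _ ht)

/-- If `u` oscillates at most by `h x + h y` between points of `s`, it is close in `L^t(s, ν)` to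
one of its values. -/
theorem exists_setLIntegral_enorm_sub_const_le {t : ℝ} (ht : 0 < t) {C : ℝ≥0} (hν : ν ≤ C • μ)
    {s E : Set X} (hs : MeasurableSet s) (hs1 : μ s ≠ ∞) (hE : μ E = 0)
    {u : X → ℝ} {h F : X → ℝ≥0∞} (hFm : Measurable F)
    (hF : ∫⁻ x, F x ∂μ ≠ ∞) (hhF : ∀ x, h x ^ t ≤ F x)
    (hu : ∀ x ∈ s, x ∉ E → ∀ y ∈ s, y ∉ E → ENNReal.ofReal |u x - u y| ≤ h x + h y) :
    ∃ c : ℝ, (μ s = 0 → c = 0) ∧ (μ s ≠ 0 → ∃ y, c = u y ∧ F y * μ s ≤ ∫⁻ x, F x ∂μ) ∧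
      ∫⁻ x in s, ‖u x - c‖ₑ ^ t ∂ν ≤ 2 ^ t * 2 * C * ∫⁻ x in s, F x ∂μ := by
  by_cases hs0 : μ s = 0
  · refine ⟨0, fun _ => rfl, fun H => absurd hs0 H, ?_⟩
    refine (setLIntegral_le_mul_of_le_smul hν s _).trans ?_
    rw [setLIntegral_measure_zero _ _ hs0]
    simp
  have hFs : ∫⁻ x in s, F x ∂μ ≤ ∫⁻ x, F x ∂μ := setLIntegral_le_lintegral _ _
  obtain ⟨y, hys, hyE, hy⟩ := exists_mem_notMem_null_mul_measure_le hs hs0 hs1 hE hFm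
    (ne_top_of_le_ne_top hF hFs)
  refine ⟨u y, fun H => absurd H hs0, fun _ => ⟨y, rfl, hy.trans hFs⟩, ?_⟩
  have hνE : ν E = 0 := by
    have := hν E
    simpa [hE] using this
  have hνs : ν s ≤ C * μ s := hν s
  calc ∫⁻ x in s, ‖u x - u y‖ₑ ^ t ∂ν ≤ ∫⁻ x in s, 2 ^ t * (F x + F y) ∂ν := by
        refine lintegral_mono_ae ?_
        filter_upwards [ae_restrict_mem hs, ae_restrict_of_ae (measure_eq_zero_iff_ae_notMem.1 hνE)]
          with x hx hxE
        refine (enorm_sub_rpow_le ht (hu x hx hxE y hys hyE)).trans ?_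
        gcongr <;> exact hhF _
    _ = 2 ^ t * (∫⁻ x in s, F x ∂ν + F y * ν s) := by
        rw [lintegral_const_mul _ (hFm.add_const _), lintegral_add_left hFm, setLIntegral_const]
    _ ≤ 2 ^ t * (C * ∫⁻ x in s, F x ∂μ + C * ∫⁻ x in s, F x ∂μ) := by
        refine mul_le_mul_right (add_le_add (setLIntegral_le_mul_of_le_smul hν s _) ?_) _
        calc F y * ν s ≤ F y * (C * μ s) := by gcongr
          _ = C * (F y * μ s) := by ring
          _ ≤ _ := by gcongr
    _ = _ := by ring

/-- Controls the tail. The first moment method finds `y ∈ B x` with `G y ≤ (∫ G ∂μ) / μ (B x)`,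
which bounds `h y` and `u y` at once; the oscillation bound carries this from `y` back to `x`. -/
theorem setLIntegral_enorm_rpow_le_of_local_bound {t : ℝ} (ht : 0 < t) {C : ℝ≥0} (hν : ν ≤ C • μ)
    {R E : Set X} (hE : μ E = 0) {B : X → Set X}
    (hB : ∀ x, MeasurableSet (B x)) (hB0 : ∀ x, μ (B x) ≠ 0) (hB1 : ∀ x, μ (B x) ≠ ∞)
    {u : X → ℝ} {h G : X → ℝ≥0∞} (hGm : Measurable G) (hG : ∫⁻ x, G x ∂μ ≠ ∞)
    (hhm : Measurable h) (hhG : ∀ x, h x ^ t + ‖u x‖ₑ ^ t ≤ G x)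
    (hu : ∀ x ∉ E, ∀ y ∈ B x, y ∉ E → ENNReal.ofReal |u x - u y| ≤ h x + h y) :
    ∫⁻ x in R, ‖u x‖ₑ ^ t ∂ν ≤ 2 ^ t * (2 ^ t + 1) *
      (C * ∫⁻ x, h x ^ t ∂μ + (∫⁻ x, G x ∂μ) * ∫⁻ x in R, (μ (B x))⁻¹ ∂ν) := by
  have hνE : ν E = 0 := by
    have := hν E
    simpa [hE] using this
  have hpt : ∀ x ∉ E, ‖u x‖ₑ ^ t ≤
      2 ^ t * (2 ^ t + 1) * (h x ^ t + (∫⁻ x, G x ∂μ) * (μ (B x))⁻¹) := by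
    intro x hxE
    have hGs : ∫⁻ z in B x, G z ∂μ ≤ ∫⁻ x, G x ∂μ := setLIntegral_le_lintegral _ _
    obtain ⟨y, hyB, hyE, hy⟩ := exists_mem_notMem_null_mul_measure_le (hB x) (hB0 x) (hB1 x) hE hGm
      (ne_top_of_le_ne_top hG hGs)
    have hGy : G y ≤ (∫⁻ x, G x ∂μ) * (μ (B x))⁻¹ := by
      rw [← div_eq_mul_inv, ENNReal.le_div_iff_mul_le (Or.inl (hB0 x)) (Or.inl (hB1 x))]
      exact hy.trans hGs
    have h1 : h y ^ t ≤ G y := le_self_add.trans (hhG y)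
    have h2 : ‖u y‖ₑ ^ t ≤ G y := le_add_self.trans (hhG y)
    calc ‖u x‖ₑ ^ t = ‖(u x - u y) + u y‖ₑ ^ t := by rw [sub_add_cancel]
      _ ≤ (‖u x - u y‖ₑ + ‖u y‖ₑ) ^ t := by gcongr; exact enorm_add_le _ _
      _ ≤ 2 ^ t * (‖u x - u y‖ₑ ^ t + ‖u y‖ₑ ^ t) := ENNReal.add_rpow_le_two_rpow_mul _ _ ht
      _ ≤ 2 ^ t * (2 ^ t * (h x ^ t + G y) + (h x ^ t + G y)) := by
          gcongr
          · refine (enorm_sub_rpow_le ht (hu x hxE y hyB hyE)).trans ?_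
            gcongr
          · exact h2.trans le_add_self
      _ = 2 ^ t * (2 ^ t + 1) * (h x ^ t + G y) := by ring
      _ ≤ _ := by gcongr
  have hK : (2 : ℝ≥0∞) ^ t * (2 ^ t + 1) ≠ ∞ := by
    have : (2 : ℝ≥0∞) ^ t ≠ ∞ := ENNReal.rpow_ne_top_of_nonneg ht.le (by simp)
    exact ENNReal.mul_ne_top this (ENNReal.add_ne_top.2 ⟨this, by simp⟩)
  calc ∫⁻ x in R, ‖u x‖ₑ ^ t ∂ν
      ≤ ∫⁻ x in R, 2 ^ t * (2 ^ t + 1) * (h x ^ t + (∫⁻ x, G x ∂μ) * (μ (B x))⁻¹) ∂ν := by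
        refine lintegral_mono_ae (ae_restrict_of_ae ?_)
        filter_upwards [measure_eq_zero_iff_ae_notMem.1 hνE] with x hx using hpt x hx
    _ = 2 ^ t * (2 ^ t + 1) *
        (∫⁻ x in R, h x ^ t ∂ν + (∫⁻ x, G x ∂μ) * ∫⁻ x in R, (μ (B x))⁻¹ ∂ν) := by
        rw [lintegral_const_mul' _ _ hK, lintegral_add_left (hhm.pow_const t),
          lintegral_const_mul' _ _ hG]
    _ ≤ _ := by
        gcongr
        exact (setLIntegral_le_mul_of_le_smul hν R _).trans
          (mul_le_mul_right (setLIntegral_le_lintegral _ _) _)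

end Measure

/-! ### Approximation by step functions -/

section Step
variable {X : Type*} {A : ℕ → Set X} {N : ℕ}

/-- The step function with value `c i` on `A i`, `i < N`, for pairwise disjoint sets `A i`. -/
noncomputable def stepFunction (A : ℕ → Set X) (N : ℕ) (c : ℕ → ℝ) (x : X) : ℝ :=
  ∑ i ∈ Finset.range N, (A i).indicator (fun _ => c i) x

theorem stepFunction_sub (c c' : ℕ → ℝ) (x : X) :
    stepFunction A N c x - stepFunction A N c' x = stepFunction A N (fun i => c i - c' i) x := by
  simp only [stepFunction, ← Finset.sum_sub_distrib]
  refine Finset.sum_congr rfl fun i _ => ?_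
  by_cases hx : x ∈ A i <;> simp [hx]

theorem stepFunction_of_mem (hd : Pairwise (Function.onFun Disjoint A)) (c : ℕ → ℝ) {x : X} {i : ℕ}
    (hi : i < N) (hx : x ∈ A i) : stepFunction A N c x = c i := by
  rw [stepFunction, Finset.sum_eq_single i]
  · simp [hx]
  · intro j _ hj
    exact Set.indicator_of_notMem (fun hxj => Set.disjoint_left.1 (hd hj) hxj hx) _
  · simp [hi]

theorem stepFunction_of_notMem (c : ℕ → ℝ) {x : X} (hx : x ∉ ⋃ i ∈ Finset.range N, A i) :
    stepFunction A N c x = 0 := by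
  refine Finset.sum_eq_zero fun i hi => Set.indicator_of_notMem (fun hxi => hx ?_) _
  exact Set.mem_biUnion hi hxi

variable [MeasurableSpace X] {μ ν : Measure X}

theorem measurable_stepFunction (hA : ∀ i, MeasurableSet (A i)) (c : ℕ → ℝ) :
    Measurable (stepFunction A N c) :=
  Finset.measurable_fun_sum _ fun i _ => measurable_const.indicator (hA i)

theorem lintegral_enorm_sub_stepFunction (hA : ∀ i, MeasurableSet (A i))
    (hd : Pairwise (Function.onFun Disjoint A)) (c : ℕ → ℝ) (u : X → ℝ) (t : ℝ) :
    ∫⁻ x, ‖u x - stepFunction A N c x‖ₑ ^ t ∂ν =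
      ∑ i ∈ Finset.range N, ∫⁻ x in A i, ‖u x - c i‖ₑ ^ t ∂ν +
        ∫⁻ x in (⋃ i ∈ Finset.range N, A i)ᶜ, ‖u x‖ₑ ^ t ∂ν := by
  have hU : MeasurableSet (⋃ i ∈ Finset.range N, A i) :=
    Finset.measurableSet_biUnion _ fun i _ => hA i
  rw [← lintegral_add_compl _ hU,
    lintegral_biUnion_finset (fun i _ j _ hij => hd hij) (fun i _ => hA i)]
  congr 1
  · refine Finset.sum_congr rfl fun i hi => setLIntegral_congr_fun (hA i) fun x hx => ?_
    simp only [stepFunction_of_mem hd c (Finset.mem_range.1 hi) hx]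
  · refine setLIntegral_congr_fun hU.compl fun x hx => ?_
    simp only [stepFunction_of_notMem c hx, sub_zero]

theorem lintegral_enorm_stepFunction (hA : ∀ i, MeasurableSet (A i))
    (hd : Pairwise (Function.onFun Disjoint A)) (c : ℕ → ℝ) {t : ℝ} (ht : 0 < t) :
    ∫⁻ x, ‖stepFunction A N c x‖ₑ ^ t ∂ν = ∑ i ∈ Finset.range N, ‖c i‖ₑ ^ t * ν (A i) := by
  have h := lintegral_enorm_sub_stepFunction (ν := ν) (N := N) hA hd c 0 t
  simpa [ENNReal.zero_rpow_of_pos ht] using h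

/-- The data of an approximate finite partition of `X` into sets of small diameter. -/
structure IsFinePartition (d : X → X → ℝ) (μ ν : Measure X) (r : ℝ) (η : ℝ≥0∞)
    (A : ℕ → Set X) (N : ℕ) (B : X → Set X) : Prop where
  measurableSet : ∀ i, MeasurableSet (A i)
  disjoint : Pairwise (Function.onFun Disjoint A)
  measure_ne_top : ∀ i, μ (A i) ≠ ∞
  dist_lt : ∀ i, ∀ x ∈ A i, ∀ y ∈ A i, d x y < r
  measurableSet_nhd : ∀ x, MeasurableSet (B x)
  measure_nhd_ne_zero : ∀ x, μ (B x) ≠ 0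
  measure_nhd_ne_top : ∀ x, μ (B x) ≠ ∞
  dist_nhd_lt : ∀ x, ∀ y ∈ B x, d x y < r
  lintegral_le : ∫⁻ x in (⋃ i ∈ Finset.range N, A i)ᶜ, (μ (B x))⁻¹ ∂ν ≤ η

/-- Off a null set, `u` oscillates at most by `h x + h y` at distances smaller than `r`. -/
def OscillationBound (d : X → X → ℝ) (μ : Measure X) (r : ℝ) (u : X → ℝ) (h : X → ℝ≥0∞) : Prop :=
  Measurable h ∧ ∃ E : Set X, μ E = 0 ∧
    ∀ x ∉ E, ∀ y ∉ E, d x y < r → ENNReal.ofReal |u x - u y| ≤ h x + h y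

/-- The values of the step function are values of `u` at points of the pieces, bounded independently
of `u` so that they can later be put in a compact set. The two error terms come from the pieces and
from the remainder. -/
theorem exists_stepFunction_approx {d : X → X → ℝ} {r : ℝ} {η : ℝ≥0∞} {B : X → Set X}
    (hP : IsFinePartition d μ ν r η A N B) {t : ℝ} (ht : 0 < t) {C : ℝ≥0} (hν : ν ≤ C • μ)
    {u : X → ℝ} (hum : Measurable u) {M ε : ℝ≥0∞} (hM0 : M ≠ 0) (hM : M ≠ ∞) (hε0 : ε ≠ 0)
    (hε : ε ≠ ∞) (hu : ∫⁻ x, ‖u x‖ₑ ^ t ∂μ ≤ M) {h : X → ℝ≥0∞}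
    (hh : OscillationBound d μ r u h) (hhε : ∫⁻ x, h x ^ t ∂μ ≤ ε) :
    ∃ c : ℕ → ℝ, (∀ i, |c i| ≤ ((2 * M / μ (A i)) ^ (1 / t)).toReal) ∧
      ∫⁻ x, ‖u x - stepFunction A N c x‖ₑ ^ t ∂ν ≤
        2 ^ t * 2 * C * (2 * ε) + 2 ^ t * (2 ^ t + 1) * (C * ε + (ε + M) * η) := by
  obtain ⟨hhm, E, hE, hosc⟩ := hh
  have hutm : Measurable fun x => ‖u x‖ₑ ^ t := hum.enorm.pow_const t
  have hδ0 : ε / M ≠ 0 := ENNReal.div_ne_zero.2 ⟨hε0, hM⟩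
  have hδ : ε / M ≠ ∞ := ENNReal.div_ne_top hε hM0
  -- The chosen point must control both `h` and `|u|`. The weight `ε / M` makes the second term
  -- contribute at most `ε`, so the size bound on the values costs only a factor 2 in the error.
  let F : X → ℝ≥0∞ := fun x => h x ^ t + ε / M * ‖u x‖ₑ ^ t
  have hFm : Measurable F := (hhm.pow_const t).add (hutm.const_mul _)
  have hF : ∫⁻ x, F x ∂μ ≤ 2 * ε := by
    rw [lintegral_add_left (hhm.pow_const t), lintegral_const_mul _ hutm, two_mul]
    gcongr
    calc ε / M * ∫⁻ x, ‖u x‖ₑ ^ t ∂μ ≤ ε / M * M := by gcongr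
      _ = ε := ENNReal.div_mul_cancel hM0 hM
  have hF' : ∫⁻ x, F x ∂μ ≠ ∞ := ne_top_of_le_ne_top (ENNReal.mul_ne_top (by simp) hε) hF
  choose c hc0 hc hcA using fun i => exists_setLIntegral_enorm_sub_const_le ht hν
    (hP.measurableSet i) (hP.measure_ne_top i) hE hFm hF' (fun _ => le_self_add)
    (fun x hx hxE y hy hyE => hosc x hxE y hyE (hP.dist_lt i x hx y hy))
  refine ⟨c, fun i => ?_, ?_⟩
  · by_cases hi : μ (A i) = 0
    · simp [hc0 i hi]
    obtain ⟨y, hy, hle⟩ := hc i hi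
    have h1 : ε / M * (‖u y‖ₑ ^ t * μ (A i)) ≤ ε / M * (2 * M) := by
      calc ε / M * (‖u y‖ₑ ^ t * μ (A i)) = (ε / M * ‖u y‖ₑ ^ t) * μ (A i) := by ring
        _ ≤ F y * μ (A i) := by gcongr; exact le_add_self
        _ ≤ 2 * ε := hle.trans hF
        _ = 2 * (ε / M * M) := by rw [ENNReal.div_mul_cancel hM0 hM]
        _ = _ := by ring
    have h2 : ‖u y‖ₑ ^ t * μ (A i) ≤ 2 * M := (ENNReal.mul_le_mul_iff_right hδ0 hδ).1 h1
    have h3 : ‖u y‖ₑ ^ t ≤ 2 * M / μ (A i) := by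
      rwa [ENNReal.le_div_iff_mul_le (Or.inl hi) (Or.inl (hP.measure_ne_top i))]
    have h4 : ‖u y‖ₑ ≤ (2 * M / μ (A i)) ^ (1 / t) := by
      rwa [one_div, ENNReal.le_rpow_inv_iff ht]
    have h5 : (2 * M / μ (A i)) ^ (1 / t) ≠ ∞ :=
      ENNReal.rpow_ne_top_of_nonneg (by positivity)
        (ENNReal.div_ne_top (ENNReal.mul_ne_top (by simp) hM) hi)
    have h6 := ENNReal.toReal_mono h5 h4
    rwa [hy, ← Real.norm_eq_abs, ← toReal_enorm]
  · rw [lintegral_enorm_sub_stepFunction hP.measurableSet hP.disjoint]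
    refine add_le_add ?_ ?_
    · calc ∑ i ∈ Finset.range N, ∫⁻ x in A i, ‖u x - c i‖ₑ ^ t ∂ν
          ≤ ∑ i ∈ Finset.range N, 2 ^ t * 2 * C * ∫⁻ x in A i, F x ∂μ :=
            Finset.sum_le_sum fun i _ => hcA i
        _ = 2 ^ t * 2 * C * ∫⁻ x in ⋃ i ∈ Finset.range N, A i, F x ∂μ := by
            rw [← Finset.mul_sum, lintegral_biUnion_finset (fun i _ j _ hij => hP.disjoint hij)
              (fun i _ => hP.measurableSet i)]
        _ ≤ _ := by
            gcongr
            exact (setLIntegral_le_lintegral _ _).trans hF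
    · have hG : ∫⁻ x, (h x ^ t + ‖u x‖ₑ ^ t) ∂μ ≤ ε + M := by
        rw [lintegral_add_left (hhm.pow_const t)]
        gcongr
      refine (setLIntegral_enorm_rpow_le_of_local_bound ht hν hE hP.measurableSet_nhd
        hP.measure_nhd_ne_zero hP.measure_nhd_ne_top ((hhm.pow_const t).add hutm)
        (ne_top_of_le_ne_top (ENNReal.add_ne_top.2 ⟨hε, hM⟩) hG) hhm (fun _ => le_rfl)
        (fun x hx y hy hyE => hosc x hx y hyE (hP.dist_nhd_lt x y hy))).trans ?_
      exact mul_le_mul_right (add_le_add (mul_le_mul_right hhε _) (mul_le_mul' hG hP.lintegral_le)) _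

end Step

/-! ### Extraction of a convergent subsequence -/

section Compactness
variable {X : Type*} [MeasurableSpace X] {μ ν : Measure X}

/-- `X` has approximate finite partitions of arbitrarily small diameter and defect. -/
def HasFinePartitions (d : X → X → ℝ) (μ ν : Measure X) : Prop :=
  ∀ r : ℝ, 0 < r → ∀ η : ℝ≥0∞, η ≠ 0 → ∃ A N B, IsFinePartition d μ ν r η A N B

/-- Total boundedness in `L^t(ν)`: for each accuracy the partition and the bounds on the values are
the same for all `n`, so only boundedly many parameters vary on each of finitely many pieces. -/
theorem exists_subseq_tendsto_of_hasFinePartitions {d : X → X → ℝ} (hd : HasFinePartitions d μ ν)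
    {C : ℝ≥0} (hν : ν ≤ C • μ) {t : ℝ} (ht : 0 < t) {u : ℕ → X → ℝ} (hum : ∀ n, Measurable (u n))
    {M : ℝ≥0∞} (hM : M ≠ ∞) (hu : ∀ n, ∫⁻ x, ‖u n x‖ₑ ^ t ∂μ ≤ M)
    (hosc : ∀ ε : ℝ≥0∞, ε ≠ 0 → ∃ r : ℝ, 0 < r ∧ ∀ n, ∃ h, OscillationBound d μ r (u n) h ∧
      ∫⁻ x, h x ^ t ∂μ ≤ ε) :
    ∃ φ : ℕ → ℕ, StrictMono φ ∧ ∃ f : X → ℝ, Measurable f ∧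
      Tendsto (fun n => ∫⁻ x, ‖u (φ n) x - f x‖ₑ ^ t ∂ν) atTop (𝓝 0) := by
  wlog hM0 : M ≠ 0 generalizing M
  · exact this (M := 1) (by simp) (fun n => (hu n).trans (by simp [not_not.1 hM0])) (by simp)
  have h2t : (2 : ℝ≥0∞) ^ t ≠ ∞ := ENNReal.rpow_ne_top_of_nonneg ht.le (by simp)
  let K : ℝ≥0∞ := 2 ^ t * 2 * C * 2 + 2 ^ t * (2 ^ t + 1) * (C + 1)
  have hK : K ≠ ∞ := by
    have h3 : (2 : ℝ≥0∞) ^ t * 2 * C * 2 ≠ ∞ :=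
      ENNReal.mul_ne_top (ENNReal.mul_ne_top (ENNReal.mul_ne_top h2t (by simp)) (by simp)) (by simp)
    have h4 : (2 : ℝ≥0∞) ^ t * (2 ^ t + 1) * (C + 1) ≠ ∞ :=
      ENNReal.mul_ne_top (ENNReal.mul_ne_top h2t (ENNReal.add_ne_top.2 ⟨h2t, by simp⟩))
        (ENNReal.add_ne_top.2 ⟨by simp, by simp⟩)
    exact ENNReal.add_ne_top.2 ⟨h3, h4⟩
  have approx : ∀ ε : ℝ≥0∞, ε ≠ 0 → ε ≠ ∞ → ∃ (A : ℕ → Set X) (N : ℕ) (b : ℕ → ℝ),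
      (∀ i, MeasurableSet (A i)) ∧ Pairwise (Function.onFun Disjoint A) ∧ (∀ i, ν (A i) ≠ ∞) ∧
      ∀ n, ∃ c : ℕ → ℝ, (∀ i, |c i| ≤ b i) ∧
        ∫⁻ x, ‖u n x - stepFunction A N c x‖ₑ ^ t ∂ν ≤ K * ε := by
    intro ε hε0 hε
    obtain ⟨r, hr, hh⟩ := hosc ε hε0
    have hεM : ε + M ≠ ∞ := ENNReal.add_ne_top.2 ⟨hε, hM⟩
    -- The defect is chosen to make the tail term `(ε + M) * η` equal to `ε`.
    obtain ⟨A, N, B, hP⟩ := hd r hr (ε / (ε + M)) (ENNReal.div_ne_zero.2 ⟨hε0, hεM⟩)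
    refine ⟨A, N, fun i => ((2 * M / μ (A i)) ^ (1 / t)).toReal, hP.measurableSet, hP.disjoint,
      fun i => ne_top_of_le_ne_top (ENNReal.mul_ne_top (by simp) (hP.measure_ne_top i)) (hν (A i)),
      fun n => ?_⟩
    obtain ⟨h, hb, hhε⟩ := hh n
    obtain ⟨c, hc, hle⟩ :=
      exists_stepFunction_approx hP ht hν (hum n) hM0 hM hε0 hε (hu n) hb hhε
    refine ⟨c, hc, hle.trans (le_of_eq ?_)⟩
    rw [ENNReal.mul_div_cancel (by simp [hε0]) hεM]
    ring
  let e : ℕ → ℝ≥0∞ := fun k => ((k : ℝ≥0∞) + 1)⁻¹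
  have he0 : ∀ k, e k ≠ 0 := fun k => by simp [e]
  have he : ∀ k, e k ≠ ∞ := fun k => by simp [e]
  have helim : Tendsto e atTop (𝓝 0) := by
    have := (tendsto_add_atTop_iff_nat 1).2 ENNReal.tendsto_inv_nat_nhds_zero
    simpa [e] using this
  choose A N b hAm hAd hAν c hcb hc using fun k => approx (e k) (he0 k) (he k)
  -- Compactness of the countable product of intervals replaces a diagonal argument: one subsequence
  -- makes the values converge for all accuracies `k` and all pieces `i`.
  obtain ⟨a, -, φ, hφ, hlim⟩ := (isCompact_univ_pi fun k => isCompact_univ_pi fun i =>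
    isCompact_Icc (a := -b k i) (b := b k i)).tendsto_subseq
    (x := fun n k i => c k n i) (fun n k _ i _ => abs_le.1 (hcb k n i))
  have hstep : ∀ k, ∀ᶠ n in atTop,
      ∫⁻ x, ‖u (φ n) x - stepFunction (A k) (N k) (a k) x‖ₑ ^ t ∂ν ≤ 2 ^ t * ((K + 1) * e k) := by
    intro k
    have hk : Tendsto (fun n => ∑ i ∈ Finset.range (N k),
        ‖c k (φ n) i - a k i‖ₑ ^ t * ν (A k i)) atTop (𝓝 0) := by
      rw [show (0 : ℝ≥0∞) = ∑ i ∈ Finset.range (N k), 0 by simp]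
      refine tendsto_finsetSum _ fun i _ => ?_
      have h1 : Tendsto (fun n => c k (φ n) i) atTop (𝓝 (a k i)) :=
        (tendsto_pi_nhds.1 (tendsto_pi_nhds.1 hlim k) i)
      have h2 : Tendsto (fun n => ‖c k (φ n) i - a k i‖ₑ ^ t) atTop (𝓝 0) := by
        have h3 := (ENNReal.continuous_rpow_const (y := t)).tendsto _ |>.comp
          ((continuous_enorm.tendsto _).comp (h1.sub_const (a k i)))
        simpa [ENNReal.zero_rpow_of_pos ht, Function.comp_def] using h3
      simpa using ENNReal.Tendsto.mul_const h2 (Or.inr (hAν k i))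
    filter_upwards [ENNReal.tendsto_nhds_zero.1 hk (e k) (pos_iff_ne_zero.2 (he0 k))] with n hn
    calc ∫⁻ x, ‖u (φ n) x - stepFunction (A k) (N k) (a k) x‖ₑ ^ t ∂ν
        ≤ ∫⁻ x, 2 ^ t * (‖u (φ n) x - stepFunction (A k) (N k) (c k (φ n)) x‖ₑ ^ t +
            ‖stepFunction (A k) (N k) (fun i => c k (φ n) i - a k i) x‖ₑ ^ t) ∂ν := by
          refine lintegral_mono fun x => ?_
          refine le_trans ?_ (ENNReal.add_rpow_le_two_rpow_mul _ _ ht)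
          rw [← stepFunction_sub, ← sub_add_sub_cancel _ (stepFunction (A k) (N k) (c k (φ n)) x)]
          gcongr
          exact enorm_add_le _ _
      _ = 2 ^ t * (∫⁻ x, ‖u (φ n) x - stepFunction (A k) (N k) (c k (φ n)) x‖ₑ ^ t ∂ν +
            ∑ i ∈ Finset.range (N k), ‖c k (φ n) i - a k i‖ₑ ^ t * ν (A k i)) := by
          rw [lintegral_const_mul' _ _ h2t, lintegral_add_right _
            ((measurable_stepFunction (hAm k) _).enorm.pow_const t),
            lintegral_enorm_stepFunction (hAm k) (hAd k) _ ht]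
      _ ≤ 2 ^ t * (K * e k + e k) := by gcongr; exact hc k (φ n)
      _ = _ := by ring
  obtain ⟨f, hf, hfl⟩ := exists_tendsto_lintegral_rpow_of_cauchy (ν := ν) ht
    (fun n => hum (φ n)) fun ε hε => by
    have hlim2 : Tendsto (fun k => 2 ^ t * (2 * (2 ^ t * ((K + 1) * e k)))) atTop (𝓝 0) := by
      have := ENNReal.Tendsto.const_mul (a := 2 ^ t * (2 * (2 ^ t * (K + 1)))) helim
        (Or.inr (ENNReal.mul_ne_top h2t (ENNReal.mul_ne_top (by simp)
          (ENNReal.mul_ne_top h2t (ENNReal.add_ne_top.2 ⟨hK, by simp⟩)))))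
      simpa [mul_assoc] using this
    obtain ⟨k, hk⟩ := (ENNReal.tendsto_nhds_zero.1 hlim2 ε (pos_iff_ne_zero.2 hε)).exists
    obtain ⟨n₀, hn₀⟩ := eventually_atTop.1 (hstep k)
    refine ⟨n₀, fun m hm n hn => le_trans ?_ hk⟩
    let s := stepFunction (A k) (N k) (a k)
    have hsm : Measurable fun x => ‖u (φ n) x - s x‖ₑ ^ t :=
      ((hum _).sub (measurable_stepFunction (hAm k) _)).enorm.pow_const t
    calc ∫⁻ x, ‖u (φ m) x - u (φ n) x‖ₑ ^ t ∂ν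
        ≤ ∫⁻ x, 2 ^ t * (‖u (φ m) x - s x‖ₑ ^ t + ‖u (φ n) x - s x‖ₑ ^ t) ∂ν := by
          refine lintegral_mono fun x => ?_
          refine le_trans ?_ (ENNReal.add_rpow_le_two_rpow_mul _ _ ht)
          rw [← sub_sub_sub_cancel_right _ _ (s x)]
          gcongr
          exact enorm_sub_le
      _ = 2 ^ t * (∫⁻ x, ‖u (φ m) x - s x‖ₑ ^ t ∂ν + ∫⁻ x, ‖u (φ n) x - s x‖ₑ ^ t ∂ν) := by
          rw [lintegral_const_mul' _ _ h2t, lintegral_add_right _ hsm]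
      _ ≤ _ := by
          rw [two_mul]
          gcongr
          · exact hn₀ m hm
          · exact hn₀ n hn
  exact ⟨φ, hφ, f, hf, hfl⟩

end Compactness

/-! ### Nets and fine partitions -/

section Geometry
variable {X : Type*} {d : X → X → ℝ}

/-- A single constant controls both the quasi-symmetry and the quasi-triangle inequality. -/
theorem IsQuasiMetric.exists_const (hd : IsQuasiMetric d) : ∃ D : ℝ, 0 < D ∧
    (∀ x y, d y x ≤ D * d x y) ∧
    (∀ x y z ρ, d z x < ρ → d z y < ρ → d x y < D * ρ) ∧
    (∀ x y z ρ, d x z < ρ → d y z < ρ → d x y < D * ρ) := by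
  obtain ⟨C₀, h₀, hs⟩ := hd.quasi_symm
  obtain ⟨C₁, h₁, ht⟩ := hd.quasi_triangle
  have hs' : ∀ x y, d y x ≤ max C₀ 1 * d x y := fun x y =>
    (hs x y).trans (mul_le_mul_of_nonneg_right (le_max_left _ _) (hd.nonneg _ _))
  have hm : 0 < max C₀ 1 := h₀.trans_le (le_max_left _ _)
  have hlt : ∀ x z ρ, d z x < ρ → d x z < max C₀ 1 * ρ := fun x z ρ h =>
    (hs' z x).trans_lt (mul_lt_mul_of_pos_left h hm)
  have hlt' : ∀ x y ρ, d x y < ρ → d x y < max C₀ 1 * ρ := fun x y ρ h =>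
    h.trans_le (le_mul_of_one_le_left ((hd.nonneg x y).trans h.le) (le_max_right _ _))
  have htri : ∀ x y z ρ, d x z < max C₀ 1 * ρ → d z y < max C₀ 1 * ρ →
      d x y < max C₁ 1 * max C₀ 1 * ρ := fun x y z ρ h h' => by
    have hρ : 0 < max C₀ 1 * ρ := (hd.nonneg x z).trans_lt h
    calc d x y ≤ C₁ * max (d x z) (d z y) := ht x y z
      _ < C₁ * (max C₀ 1 * ρ) := mul_lt_mul_of_pos_left (max_lt h h') h₁
      _ ≤ max C₁ 1 * (max C₀ 1 * ρ) := mul_le_mul_of_nonneg_right (le_max_left _ _) hρ.le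
      _ = _ := by ring
  refine ⟨max C₁ 1 * max C₀ 1, by positivity, fun x y => ?_, fun x y z ρ h h' => ?_,
    fun x y z ρ h h' => ?_⟩
  · refine (hs' x y).trans ?_
    rw [mul_assoc]
    exact le_mul_of_one_le_left (mul_nonneg hm.le (hd.nonneg _ _)) (le_max_right _ _)
  · exact htri x y z ρ (hlt x z ρ h) (hlt' z y ρ h')
  · exact htri x y z ρ (hlt' x z ρ h) (hlt z y ρ h')

variable [MeasurableSpace X] {μ ν : Measure X}

theorem IsQuasiMetricMeasureSpace.sigmaFinite [Nonempty X] (hX : IsQuasiMetricMeasureSpace d μ) :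
    SigmaFinite μ := by
  obtain ⟨x₀⟩ := ‹Nonempty X›
  refine ⟨⟨⟨fun n => quasiBall d x₀ (n + 1), fun _ => trivial,
    fun n => hX.ball_lt_top _ _ (by positivity), Set.eq_univ_of_forall fun x => ?_⟩⟩⟩
  obtain ⟨n, hn⟩ := exists_nat_gt (d x₀ x)
  exact Set.mem_iUnion.2 ⟨n, show d x₀ x < n + 1 by linarith⟩

/-- A quasi-metric-measure space has countable nets at every scale. -/
theorem IsQuasiMetricMeasureSpace.exists_net [Nonempty X] (hX : IsQuasiMetricMeasureSpace d μ)
    {r : ℝ} (hr : 0 < r) : ∃ e : ℕ → X, ∀ x, ∃ i, d (e i) x < r := by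
  have := hX.sigmaFinite
  have hd := hX.isQuasiMetric
  obtain ⟨D, hD, hsymm, -, htri⟩ := hd.exists_const
  -- As `d` need not be symmetric, separation concerns both orders; with this `r'`, a point at
  -- distance at least `r` from the net in one order is `r'`-separated from it in both.
  set r' := min r (r / D) with hr'
  have hr'0 : 0 < r' := lt_min hr (div_pos hr hD)
  obtain ⟨s, hs⟩ := zorn_subset {s : Set X | s.Pairwise fun x y => r' ≤ d x y}
    fun c hc hchain => ⟨⋃₀ c, (Set.pairwise_sUnion hchain.directedOn).2 fun t ht => hc ht,
      fun t ht => Set.subset_sUnion_of_mem ht⟩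
  have hnet : ∀ x, ∃ y ∈ s, d y x < r := by
    intro x
    by_contra! H
    have hxs : x ∉ s := fun hx => by
      have := H x hx
      rw [(hd.eq_zero_iff x x).2 rfl] at this
      linarith
    refine hxs (hs.2 (y := insert x s) ?_ (Set.subset_insert _ _) (Set.mem_insert _ _))
    refine (Set.pairwise_insert_of_notMem hxs).2 ⟨hs.1, fun y hy => ⟨?_, ?_⟩⟩
    · refine (min_le_right _ _).trans ((div_le_iff₀' hD).2 ?_)
      exact (H y hy).trans (hsymm x y)
    · exact (min_le_left _ _).trans (H y hy)
  have hρ : 0 < r' / D := div_pos hr'0 hD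
  -- Balls of radius `r' / D` around separated points are disjoint and of positive measure, and a
  -- σ-finite measure admits only countably many such sets.
  have hcount : s.Countable := by
    have h := Measure.countable_meas_pos_of_disjoint_iUnion (μ := μ)
      (As := fun y : s => quasiBall d (y : X) (r' / D)) (fun y => hX.measurableSet_ball _ _ hρ) ?_
    · rw [← Set.countable_coe_iff]
      refine Set.countable_univ_iff.1 (h.mono fun y _ => ?_)
      exact hX.ball_pos _ _ hρ
    · intro y y' hyy'
      refine Set.disjoint_left.2 fun z hz hz' => ?_
      have h1 := htri (y : X) y' z _ hz hz'
      rw [mul_div_cancel₀ _ hD.ne'] at h1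
      exact (hs.1 y.2 y'.2 (fun h => hyy' (Subtype.ext h))).not_gt h1
  have hne : s.Nonempty := by
    obtain ⟨x₀⟩ := ‹Nonempty X›
    obtain ⟨y, hy, -⟩ := hnet x₀
    exact ⟨y, hy⟩
  obtain ⟨e, rfl⟩ := hcount.exists_eq_range hne
  refine ⟨e, fun x => ?_⟩
  obtain ⟨_, ⟨i, rfl⟩, hi⟩ := hnet x
  exact ⟨i, hi⟩

/-- Making the balls disjoint keeps the union of the first `N`, since a covered point lies in the
piece of least index. The neighbourhoods `B x` stay free so that they may be balls of an equivalent
quasi-metric. -/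
theorem IsQuasiMetricMeasureSpace.isFinePartition_disjointed (hX : IsQuasiMetricMeasureSpace d μ)
    {ρ r : ℝ} (hρ : 0 < ρ) (hρr : ∀ x y z, d z x < ρ → d z y < ρ → d x y < r) (e : ℕ → X) {N : ℕ}
    {η : ℝ≥0∞} {B : X → Set X} (hB : ∀ x, MeasurableSet (B x))
    (hB0 : ∀ x, ∃ s, 0 < s ∧ quasiBall d x s ⊆ B x) (hBr : ∀ x, ∀ y ∈ B x, d x y < r)
    (hη : ∫⁻ x in (⋃ i ∈ Finset.range N, quasiBall d (e i) ρ)ᶜ, (μ (B x))⁻¹ ∂ν ≤ η) :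
    IsFinePartition d μ ν r η (disjointed fun i => quasiBall d (e i) ρ) N B where
  measurableSet := MeasurableSet.disjointed fun i => hX.measurableSet_ball _ _ hρ
  disjoint := disjoint_disjointed _
  measure_ne_top i := ne_top_of_le_ne_top (hX.ball_lt_top (e i) ρ hρ).ne
    (measure_mono (disjointed_subset _ i))
  dist_lt i x hx y hy := hρr x y (e i) (disjointed_subset _ i hx) (disjointed_subset _ i hy)
  measurableSet_nhd := hB
  measure_nhd_ne_zero x := by
    obtain ⟨s, hs, hsub⟩ := hB0 x
    exact ((hX.ball_pos x s hs).trans_le (measure_mono hsub)).ne'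
  measure_nhd_ne_top x := by
    obtain ⟨s, hs, hsub⟩ := hB0 x
    have hr : 0 < r := (hX.isQuasiMetric.nonneg x x).trans_lt
      (hBr x x (hsub (show d x x < s by rwa [(hX.isQuasiMetric.eq_zero_iff x x).2 rfl])))
    exact ne_top_of_le_ne_top (hX.ball_lt_top x r hr).ne (measure_mono (hBr x))
  dist_nhd_lt := hBr
  lintegral_le := by
    refine le_trans (lintegral_mono_set (Set.compl_subset_compl.2 fun x hx => ?_)) hη
    simp only [Set.mem_iUnion, Finset.mem_range, exists_prop] at hx ⊢
    classical
    have hex : ∃ i, x ∈ quasiBall d (e i) ρ := hx.imp fun i h => h.2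
    obtain ⟨i, hi, hxi⟩ := hx
    refine ⟨Nat.find hex, (Nat.find_min' hex hxi).trans_lt hi, ?_⟩
    rw [disjointed_eq_inter_compl]
    exact ⟨Nat.find_spec hex, Set.mem_iInter₂.2 fun j hj => Nat.find_min hex hj⟩

theorem IsQuasiMetricMeasureSpace.hasFinePartitions_of_isIntegrableMeasure [Nonempty X]
    (hX : IsQuasiMetricMeasureSpace d μ) (hI : IsIntegrableMeasure d μ ν) :
    HasFinePartitions d μ ν := by
  intro r hr η hη
  obtain ⟨D, hD, -, hdiam, -⟩ := hX.isQuasiMetric.exists_const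
  obtain ⟨σ, -, ⟨κ, hκ, hequiv⟩, hσm, hσ⟩ := hI
  have hρ : 0 < r / D := div_pos hr hD
  obtain ⟨e, he⟩ := hX.exists_net hρ
  have hrκ : 0 < r / κ := div_pos hr hκ
  obtain ⟨hgm, hgI⟩ := hσ (r / κ) hrκ
  let U : ℕ → Set X := fun N => (⋃ i ∈ Finset.range N, quasiBall d (e i) (r / D))ᶜ
  have hU : ∀ N, MeasurableSet (U N) := fun N =>
    (Finset.measurableSet_biUnion _ fun i _ => hX.measurableSet_ball _ _ hρ).compl
  -- A finite measure by integrability; the uncovered sets `U N` decrease to the empty set, so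
  -- continuity from above makes their `w`-measure tend to zero.
  let w := ν.withDensity fun x => (μ (quasiBall σ x (r / κ)))⁻¹
  have hw : w Set.univ ≠ ∞ := by
    rw [withDensity_apply _ MeasurableSet.univ, Measure.restrict_univ]
    exact hgI.ne
  have hlim : Tendsto (fun N => w (U N)) atTop (𝓝 0) := by
    have h := tendsto_measure_iInter_atTop (μ := w) (s := U)
      (fun N => (hU N).nullMeasurableSet) (fun m n hmn => ?_)
      ⟨0, ne_top_of_le_ne_top hw (measure_mono (Set.subset_univ _))⟩
    · have hempty : ⋂ N, U N = ∅ := by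
        refine Set.eq_empty_of_forall_notMem fun x hx => ?_
        obtain ⟨i, hi⟩ := he x
        exact Set.mem_iInter.1 hx (i + 1)
          (Set.mem_biUnion (Finset.mem_coe.2 (Finset.self_mem_range_succ i)) hi)
      rwa [hempty, measure_empty] at h
    · exact Set.compl_subset_compl.2
        (Set.biUnion_subset_biUnion_left (Finset.range_mono hmn))
  obtain ⟨N, hN⟩ := (ENNReal.tendsto_nhds_zero.1 hlim η (pos_iff_ne_zero.2 hη)).exists
  rw [withDensity_apply _ (hU N)] at hN
  refine ⟨_, N, fun x => quasiBall σ x (r / κ), hX.isFinePartition_disjointed hρ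
    (fun x y z h h' => ?_) e (fun x => hσm x _ hrκ) (fun x => ⟨r / κ / κ, div_pos hrκ hκ,
      fun y hy => ?_⟩) (fun x y hy => ?_) hN⟩
  · simpa [mul_div_cancel₀ _ hD.ne'] using hdiam x y z _ h h'
  · have h1 : d x y < r / κ / κ := hy
    have h2 := (hequiv x y).1
    rw [inv_mul_le_iff₀ hκ] at h2
    rw [lt_div_iff₀' hκ] at h1
    exact h2.trans_lt h1
  · have h1 : σ x y < r / κ := hy
    rw [lt_div_iff₀' hκ] at h1
    exact (hequiv x y).2.trans_lt h1

theorem IsQuasiMetricMeasureSpace.hasFinePartitions_of_quasiTotallyBounded [Nonempty X]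
    (hX : IsQuasiMetricMeasureSpace d μ) (hT : QuasiTotallyBounded d) :
    HasFinePartitions d μ ν := by
  intro r hr η hη
  obtain ⟨D, hD, -, hdiam, -⟩ := hX.isQuasiMetric.exists_const
  have hρ : 0 < r / D := div_pos hr hD
  obtain ⟨s, hs, hcov⟩ := hT (r / D) hρ
  have hne : s.Nonempty := by
    obtain ⟨x₀⟩ := ‹Nonempty X›
    obtain ⟨y, hy, -⟩ := hcov x₀
    exact ⟨y, hy⟩
  obtain ⟨e, rfl⟩ := hs.countable.exists_eq_range hne
  choose j hj using fun y : Set.range e => y.2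
  have := hs.to_subtype
  -- The enumeration `e` of the finite net repeats points; `N` bounds one chosen index for each, so
  -- indices up to `N` already cover `X`.
  obtain ⟨N, hN⟩ := (Set.finite_range j).bddAbove
  refine ⟨_, N + 1, fun x => quasiBall d x r, hX.isFinePartition_disjointed hρ
    (fun x y z h h' => ?_) e (fun x => hX.measurableSet_ball _ _ hr) (fun x => ⟨r, hr, subset_rfl⟩)
    (fun x y hy => hy) ?_⟩
  · simpa [mul_div_cancel₀ _ hD.ne'] using hdiam x y z _ h h'
  · have huniv : ⋃ i ∈ Finset.range (N + 1), quasiBall d (e i) (r / D) = Set.univ := by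
      refine Set.eq_univ_of_forall fun x => ?_
      obtain ⟨y, hy, hxy⟩ := hcov x
      refine Set.mem_biUnion (x := j ⟨y, hy⟩) ?_ (by rwa [hj])
      exact Finset.mem_coe.2 (Finset.mem_range_succ_iff.2 (hN ⟨_, rfl⟩))
    rw [huniv]
    simp

end Geometry

/-! ### Oscillation bounds for the three spaces -/

section Spaces
variable {X : Type*} [MeasurableSpace X] {μ ν : Measure X} {d : X → X → ℝ}

/-- Functions whose oscillation at small scales is controlled by `H` embed compactly. -/
theorem isCompactlyEmbeddedInLp_of_oscillationBound (hd : HasFinePartitions d μ ν)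
    {C : ℝ≥0} (hν : ν ≤ C • μ) {p : ℝ≥0∞} (hp0 : 0 < p) (hp : p < ∞) {H : (X → ℝ) → ℝ≥0∞}
    (hH : ∀ M : ℝ≥0, ∀ ε : ℝ≥0∞, ε ≠ 0 → ∃ r : ℝ, 0 < r ∧ ∀ u, H u ≤ M →
      ∃ h, OscillationBound d μ r u h ∧ ∫⁻ x, h x ^ p.toReal ∂μ ≤ ε) :
    IsCompactlyEmbeddedInLp (inhomSpace μ p H) (inhomNorm μ p H) p ν := by
  have ht : 0 < p.toReal := ENNReal.toReal_pos hp0.ne' hp.ne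
  have hmem : ∀ u ∈ inhomSpace μ p H, MemLp u p ν := fun u hu =>
    hu.2.1.of_measure_le_smul (c := C) (by simp) hν
  refine ⟨hmem, ⟨C ^ (1 / p).toReal, fun u _ => ?_⟩, fun u hu ⟨M, hM⟩ => ?_⟩
  · calc eLpNorm u p ν ≤ eLpNorm u p ((C : ℝ≥0∞) • μ) := eLpNorm_mono_measure _ hν
      _ ≤ (C : ℝ≥0∞) ^ (1 / p).toReal • eLpNorm u p μ := eLpNorm_smul_measure_le _ _ _ _
      _ = ((C ^ (1 / p).toReal : ℝ≥0) : ℝ≥0∞) * eLpNorm u p μ := by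
          rw [ENNReal.coe_rpow_of_nonneg _ ENNReal.toReal_nonneg, smul_eq_mul]
      _ ≤ _ := by gcongr; exact le_self_add
  · have hnorm : ∀ n, ∫⁻ x, ‖u n x‖ₑ ^ p.toReal ∂μ ≤ (M : ℝ≥0∞) ^ p.toReal := fun n => by
      have h := (le_self_add.trans (hM n) : eLpNorm (u n) p μ ≤ M)
      rwa [eLpNorm_eq_lintegral_rpow_enorm_toReal hp0.ne' hp.ne, one_div,
        ENNReal.rpow_inv_le_iff ht] at h
    obtain ⟨φ, hφ, f, hf, hlim⟩ := exists_subseq_tendsto_of_hasFinePartitions hd hν ht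
      (fun n => (hu n).1) (ENNReal.rpow_ne_top_of_nonneg ht.le (by simp)) hnorm fun ε hε => by
        obtain ⟨r, hr, h⟩ := hH M ε hε
        exact ⟨r, hr, fun n => h (u n) (le_add_self.trans (hM n))⟩
    have hlim' : Tendsto (fun n => eLpNorm (u (φ n) - f) p ν) atTop (𝓝 0) := by
      simp only [eLpNorm_eq_lintegral_rpow_enorm_toReal hp0.ne' hp.ne, Pi.sub_apply]
      have h := ((ENNReal.continuous_rpow_const (y := 1 / p.toReal)).tendsto _).comp hlim
      rwa [ENNReal.zero_rpow_of_pos (by positivity)] at h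
    refine ⟨f, ?_, φ, hφ, hlim'⟩
    obtain ⟨n, hn⟩ := (ENNReal.tendsto_nhds_zero.1 hlim' 1 one_pos).exists
    have h1 : MemLp (u (φ n) - f) p ν :=
      ⟨((hu (φ n)).1.sub hf).aestronglyMeasurable, hn.trans_lt (by simp)⟩
    simpa using (hmem _ (hu (φ n))).sub h1

theorem IsCompactlyEmbeddedInLp.mono {S S' : Set (X → ℝ)} {N N' : (X → ℝ) → ℝ≥0∞} {p : ℝ≥0∞}
    (h : IsCompactlyEmbeddedInLp S' N' p ν) (hS : S ⊆ S') (hN : ∀ u, N' u ≤ N u) :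
    IsCompactlyEmbeddedInLp S N p ν := by
  obtain ⟨h1, ⟨K, hK⟩, h3⟩ := h
  refine ⟨fun u hu => h1 u (hS hu), ⟨K, fun u hu => (hK u (hS hu)).trans ?_⟩,
    fun u hu ⟨M, hM⟩ => h3 u (fun n => hS (hu n)) ⟨M, fun n => (hN _).trans (hM n)⟩⟩
  gcongr
  exact hN u

theorem le_lqNorm {q : ℝ≥0∞} (hq : 0 < q) (a : ℤ → ℝ≥0∞) (k : ℤ) : a k ≤ lqNorm q a := by
  unfold lqNorm
  split_ifs with h
  · exact le_iSup a k
  · have hq' : 0 < q.toReal := ENNReal.toReal_pos hq.ne' h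
    rw [one_div, ENNReal.le_rpow_inv_iff hq']
    exact ENNReal.le_tsum k

theorem exists_dyadic_scale {s : ℝ} (hs : 0 < s) :
    ∃ k : ℤ, (2 : ℝ) ^ (-k - 1) ≤ s ∧ s < (2 : ℝ) ^ (-k) := by
  obtain ⟨n, hn, hn'⟩ := exists_mem_Ico_zpow hs one_lt_two
  refine ⟨-n - 1, ?_, ?_⟩
  · simpa using hn
  · rwa [show -(-n - 1) = n + 1 by ring]

/-- At distances below `r` the gradient inequality gains a factor `r ^ α`, so `h = r ^ α * g` works
for a near-optimal gradient `g`. -/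
theorem hajlaszSobolev_oscillationBound (hd : IsQuasiMetric d) {α : ℝ} (hα : 0 < α) {p : ℝ≥0∞}
    (hp0 : 0 < p) (hp : p < ∞) (M : ℝ≥0) {ε : ℝ≥0∞} (hε : ε ≠ 0) :
    ∃ r : ℝ, 0 < r ∧ ∀ u, homHajlaszSobolevNorm d μ α p u ≤ M →
      ∃ h, OscillationBound d μ r u h ∧ ∫⁻ x, h x ^ p.toReal ∂μ ≤ ε := by
  have ht : 0 < p.toReal := ENNReal.toReal_pos hp0.ne' hp.ne
  have hlim : Tendsto (fun r : ℝ => ENNReal.ofReal (r ^ α) ^ p.toReal *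
      ((M : ℝ≥0∞) + 1) ^ p.toReal) (𝓝[>] 0) (𝓝 0) := by
    have h1 : Tendsto (fun r : ℝ => ENNReal.ofReal (r ^ α) ^ p.toReal) (𝓝 0) (𝓝 0) := by
      have h2 := (ENNReal.continuous_rpow_const (y := p.toReal)).tendsto _ |>.comp
        ((ENNReal.continuous_ofReal.tendsto _).comp (Real.continuousAt_rpow_const 0 α (Or.inr hα.le)))
      simpa [Real.zero_rpow hα.ne', ENNReal.zero_rpow_of_pos ht, Function.comp_def] using h2
    simpa using ENNReal.Tendsto.mul_const (h1.mono_left nhdsWithin_le_nhds)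
      (Or.inr (ENNReal.rpow_ne_top_of_nonneg ht.le (by simp)))
  obtain ⟨r, hr, hr0⟩ := ((ENNReal.tendsto_nhds_zero.1 hlim ε (pos_iff_ne_zero.2 hε)).and
    self_mem_nhdsWithin).exists
  refine ⟨r, hr0, fun u hu => ?_⟩
  -- The infimum need not be attained; enlarging the bound makes it strict, which yields an actual
  -- gradient.
  have hu' : homHajlaszSobolevNorm d μ α p u < M + 1 :=
    hu.trans_lt (ENNReal.lt_add_right (by simp) (by simp))
  obtain ⟨g, hg⟩ := iInf_lt_iff.1 hu'
  obtain ⟨⟨hgm, E, -, hE, hgE⟩, hg⟩ := iInf_lt_iff.1 hg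
  refine ⟨fun x => ENNReal.ofReal (r ^ α) * g x, ⟨hgm.const_mul _, E, hE,
    fun x hx y hy hxy => ?_⟩, ?_⟩
  · rw [← mul_add]
    refine (hgE x hx y hy).trans ?_
    have := hd.nonneg x y
    gcongr
  · simp only [ENNReal.mul_rpow_of_nonneg _ _ ht.le]
    rw [lintegral_const_mul _ (hgm.pow_const _)]
    refine le_trans ?_ hr
    gcongr
    have h := hg.le
    rwa [eLpNorm_eq_lintegral_rpow_enorm_toReal hp0.ne' hp.ne, one_div,
      ENNReal.rpow_inv_le_iff ht] at h

/-- The pointwise supremum of a fractional gradient is a gradient. -/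
theorem IsFractionalGradient.isHajlaszGradient_iSup (hd : IsQuasiMetric d) {α : ℝ} {u : X → ℝ}
    {g : ℤ → X → ℝ≥0∞} (hg : IsFractionalGradient d μ α u g) :
    IsHajlaszGradient d μ α u (fun x => ⨆ k, g k x) := by
  obtain ⟨hgm, E, hEm, hE, h⟩ := hg
  refine ⟨Measurable.iSup hgm, E, hEm, hE, fun x hx y hy => ?_⟩
  rcases eq_or_ne x y with rfl | hxy
  · simp
  have hpos : 0 < d x y := (hd.nonneg x y).lt_of_ne' fun h0 => hxy ((hd.eq_zero_iff x y).1 h0)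
  obtain ⟨k, hk, hk'⟩ := exists_dyadic_scale hpos
  refine (h k x hx y hy hk hk').trans ?_
  gcongr
  · exact le_iSup (fun k => g k x) k
  · exact le_iSup (fun k => g k y) k

/-- The `ℓ^q` quasi-norm dominates the supremum, so the Triebel–Lizorkin case reduces to the Sobolev
one for every `q`. -/
theorem homHajlaszSobolevNorm_le_homTriebelLizorkinNorm (hd : IsQuasiMetric d) (α : ℝ)
    (p : ℝ≥0∞) {q : ℝ≥0∞} (hq : 0 < q) (u : X → ℝ) :
    homHajlaszSobolevNorm d μ α p u ≤ homTriebelLizorkinNorm d μ α p q u := by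
  refine le_iInf₂ fun g hg => (iInf₂_le _ (hg.isHajlaszGradient_iSup hd)).trans ?_
  exact eLpNorm_mono_enorm fun x => iSup_le fun k => le_lqNorm hq (fun k => g k x) k

/-- Only the uniform bound on `‖g_k‖` in `L^p` is used. At scale `2⁻ᵏ` the factor `d x y ^ α` is at
most `2 ^ (-α * k)`, and this decay makes the contributions of all scales `k ≥ n` summable, with sum
tending to zero as `n → ∞`. -/
theorem besov_oscillationBound (hd : IsQuasiMetric d) {α : ℝ} (hα : 0 < α) {p q : ℝ≥0∞}
    (hp0 : 0 < p) (hp : p < ∞) (hq : 0 < q) (M : ℝ≥0) {ε : ℝ≥0∞} (hε : ε ≠ 0) :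
    ∃ r : ℝ, 0 < r ∧ ∀ u, homBesovNorm d μ α p q u ≤ M →
      ∃ h, OscillationBound d μ r u h ∧ ∫⁻ x, h x ^ p.toReal ∂μ ≤ ε := by
  have ht : 0 < p.toReal := ENNReal.toReal_pos hp0.ne' hp.ne
  set t := p.toReal
  let w : ℝ≥0∞ := ENNReal.ofReal ((2 : ℝ) ^ (-α))
  have hw : w < 1 := by
    rw [ENNReal.ofReal_lt_one]
    exact Real.rpow_lt_one_of_one_lt_of_neg one_lt_two (neg_lt_zero.2 hα)
  have hθ : w ^ t < 1 := ENNReal.rpow_lt_one hw ht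
  have hMt : ((M : ℝ≥0∞) + 1) ^ t ≠ ∞ := ENNReal.rpow_ne_top_of_nonneg ht.le (by simp)
  have hlim : Tendsto (fun n : ℕ => (w ^ t) ^ n * ((1 - w ^ t)⁻¹ * ((M : ℝ≥0∞) + 1) ^ t))
      atTop (𝓝 0) := by
    have h := ENNReal.Tendsto.mul_const (b := (1 - w ^ t)⁻¹ * ((M : ℝ≥0∞) + 1) ^ t)
      (ENNReal.tendsto_pow_atTop_nhds_zero_of_lt_one hθ)
      (Or.inr (ENNReal.mul_ne_top (ENNReal.inv_ne_top.2 (tsub_pos_of_lt hθ).ne') hMt))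
    simpa using h
  obtain ⟨n, hn⟩ := (ENNReal.tendsto_nhds_zero.1 hlim ε (pos_iff_ne_zero.2 hε)).exists
  refine ⟨(2 : ℝ) ^ (-(n : ℤ)), by positivity, fun u hu => ?_⟩
  have hu' : homBesovNorm d μ α p q u < M + 1 :=
    hu.trans_lt (ENNReal.lt_add_right (by simp) (by simp))
  obtain ⟨g, hg⟩ := iInf_lt_iff.1 hu'
  obtain ⟨⟨hgm, E, -, hE, hgE⟩, hg⟩ := iInf_lt_iff.1 hg
  have hgk : ∀ k, ∫⁻ x, g k x ^ t ∂μ ≤ ((M : ℝ≥0∞) + 1) ^ t := fun k => by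
    have h := (le_lqNorm hq (fun k => eLpNorm (g k) p μ) k).trans hg.le
    rwa [eLpNorm_eq_lintegral_rpow_enorm_toReal hp0.ne' hp.ne, one_div,
      ENNReal.rpow_inv_le_iff ht] at h
  let a : ℕ → X → ℝ≥0∞ := fun j x => w ^ (n + j) * g ((n + j : ℕ) : ℤ) x
  have ham : ∀ j, Measurable (a j) := fun j => (hgm _).const_mul _
  -- An `ℓ^t` combination with `t = p` dominates every scale, and its `t`-th power integrates
  -- termwise, so no triangle inequality in `L^p` is needed when `p < 1`.
  let h : X → ℝ≥0∞ := fun x => (∑' j, a j x ^ t) ^ t⁻¹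
  have hah : ∀ j x, a j x ≤ h x := fun j x => by
    rw [ENNReal.le_rpow_inv_iff ht]
    exact ENNReal.le_tsum j
  refine ⟨h, ⟨(Measurable.tsum fun j => (ham j).pow_const t).pow_const _, E, hE,
    fun x hx y hy hxy => ?_⟩, ?_⟩
  · rcases eq_or_ne x y with rfl | hne
    · simp
    have hpos : 0 < d x y := (hd.nonneg x y).lt_of_ne' fun h0 => hne ((hd.eq_zero_iff x y).1 h0)
    obtain ⟨k, hk, hk'⟩ := exists_dyadic_scale hpos
    -- From `2 ^ (-k - 1) ≤ d x y < 2 ^ (-n)` one gets `n < k + 1`, so only the scales summed in `h`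
    -- occur.
    have hnk : (n : ℤ) ≤ k := by
      have := (zpow_lt_zpow_iff_right₀ one_lt_two).1 (hk.trans_lt hxy)
      omega
    obtain ⟨j, rfl⟩ : ∃ j : ℕ, k = ((n + j : ℕ) : ℤ) := ⟨(k - n).toNat, by omega⟩
    have hdw : ENNReal.ofReal (d x y ^ α) ≤ w ^ (n + j) := by
      rw [← ENNReal.ofReal_pow (by positivity)]
      refine ENNReal.ofReal_le_ofReal ?_
      calc d x y ^ α ≤ ((2 : ℝ) ^ (-((n + j : ℕ) : ℤ))) ^ α :=
            Real.rpow_le_rpow hpos.le hk'.le hα.le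
        _ = ((2 : ℝ) ^ (-α)) ^ (n + j) := by
            rw [← Real.rpow_intCast, ← Real.rpow_natCast, ← Real.rpow_mul (by simp),
              ← Real.rpow_mul (by simp)]
            congr 1
            push_cast
            ring
    calc ENNReal.ofReal |u x - u y|
        ≤ ENNReal.ofReal (d x y ^ α) * (g ((n + j : ℕ) : ℤ) x + g ((n + j : ℕ) : ℤ) y) :=
          hgE _ x hx y hy hk hk'
      _ ≤ w ^ (n + j) * (g ((n + j : ℕ) : ℤ) x + g ((n + j : ℕ) : ℤ) y) := by gcongr
      _ = a j x + a j y := mul_add _ _ _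
      _ ≤ h x + h y := add_le_add (hah j x) (hah j y)
  · calc ∫⁻ x, h x ^ t ∂μ = ∫⁻ x, ∑' j, a j x ^ t ∂μ := by
          simp only [h, ENNReal.rpow_inv_rpow ht.ne']
      _ = ∑' j, ∫⁻ x, a j x ^ t ∂μ := lintegral_tsum fun j => ((ham j).pow_const t).aemeasurable
      _ ≤ ∑' j, (w ^ t) ^ n * (w ^ t) ^ j * ((M : ℝ≥0∞) + 1) ^ t := by
          refine ENNReal.tsum_le_tsum fun j => ?_
          simp only [a, ENNReal.mul_rpow_of_nonneg _ _ ht.le]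
          rw [lintegral_const_mul _ ((hgm _).pow_const t), ← pow_add, ← ENNReal.rpow_natCast,
            ← ENNReal.rpow_natCast, ← ENNReal.rpow_mul, ← ENNReal.rpow_mul, mul_comm t]
          gcongr
          exact hgk _
      _ = (w ^ t) ^ n * ((1 - w ^ t)⁻¹ * ((M : ℝ≥0∞) + 1) ^ t) := by
          rw [ENNReal.tsum_mul_right, ENNReal.tsum_mul_left, ENNReal.tsum_geometric, mul_assoc]
      _ ≤ ε := hn

theorem HasFinePartitions.compactlyEmbeds (hP : HasFinePartitions d μ ν) (hd : IsQuasiMetric d)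
    {C : ℝ≥0} (hν : ν ≤ C • μ) {α : ℝ} (hα : 0 < α) {p q : ℝ≥0∞} (hp0 : 0 < p) (hp : p < ∞)
    (hq : 0 < q) :
    TriebelLizorkinCompactlyEmbeds d μ ν α p q ∧ BesovCompactlyEmbeds d μ ν α p q ∧
      HajlaszSobolevCompactlyEmbeds d μ ν α p := by
  have hS : HajlaszSobolevCompactlyEmbeds d μ ν α p :=
    isCompactlyEmbeddedInLp_of_oscillationBound hP hν hp0 hp fun M _ hε =>
      hajlaszSobolev_oscillationBound hd hα hp0 hp M hε
  have hle := homHajlaszSobolevNorm_le_homTriebelLizorkinNorm (μ := μ) hd α p hq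
  exact ⟨hS.mono (fun u hu => ⟨hu.1, hu.2.1, (hle u).trans_lt hu.2.2⟩)
      fun u => add_le_add_right (hle u) _,
    isCompactlyEmbeddedInLp_of_oscillationBound hP hν hp0 hp fun M _ hε =>
      besov_oscillationBound hd hα hp0 hp hq M hε, hS⟩

end Spaces

theorem mainTheorem3 {X : Type*} [Nonempty X] [MeasurableSpace X] (d : X → X → ℝ)
    (μ ν : Measure X) (hX : IsQuasiMetricMeasureSpace d μ)
    (C : ℝ≥0) (hν : ν ≤ C • μ) :
    (IsIntegrableMeasure d μ ν →
      ∀ (α : ℝ) (p q : ℝ≥0∞), 0 < α → 0 < p → p < ∞ → 0 < q →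
        TriebelLizorkinCompactlyEmbeds d μ ν α p q ∧
        BesovCompactlyEmbeds d μ ν α p q ∧
        HajlaszSobolevCompactlyEmbeds d μ ν α p) ∧
    (QuasiTotallyBounded d →
      ∀ (α : ℝ) (p q : ℝ≥0∞), 0 < α → 0 < p → p < ∞ → 0 < q →
        TriebelLizorkinCompactlyEmbeds d μ ν α p q ∧
        BesovCompactlyEmbeds d μ ν α p q ∧
        HajlaszSobolevCompactlyEmbeds d μ ν α p) := by
  exact ⟨fun hI α p q hα hp0 hp hq => (hX.hasFinePartitions_of_isIntegrableMeasure hI).compactlyEmbeds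
      hX.isQuasiMetric hν hα hp0 hp hq,
    fun hT α p q hα hp0 hp hq => (hX.hasFinePartitions_of_quasiTotallyBounded hT).compactlyEmbeds
      hX.isQuasiMetric hν hα hp0 hp hq⟩
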